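/- Let $A,B,A',B',\hat A,\hat B$ be finite-dimensional quantum systems ($A$ and $B$ nonzero), each with a fixed orthonormal basis, let $\mathcal N_{AB\to A'B'}$ be a quantum channel (a completely positive trace-preserving linear map) and let $\rho_{\hat A\hat B}$ be a quantum state (positive semi-definite, trace one). Transposes $T$ are taken in the fixed bases. A channel $\mathcal P_{A\hat AB\hat B\to A'B'}$, in which Alice holds $A,\hat A,A'$ and Bob holds $B,\hat B,B'$, is called C-PPT-P if $T_{B'}\circ\mathcal P\circ T_{B\hat B}$ is completely positive. The fidelity of states is $F(\omega,\tau)=\|\sqrt\omega\sqrt\tau\|_1^2$, and the fidelity of channels is $F(\mathcal N,\mathcal M)=\inf_{\rho_{RC}}F\big((\mathrm{id}_R\otimes\mathcal N)(\rho_{RC}),(\mathrm{id}_R\otimes\mathcal M)(\rho_{RC})\big)$, where the infimum is over all states $\rho_{RC}$ of the input system $C$ and a reference system $R$ of arbitrary finite dimension. Define the simulation error $$e^F_{\mathrm{PPT}}(\mathcal N,\rho_{\hat A\hat B})=\inf_{\mathcal P\in\text{C-PPT-P}}\big(1-F(\mathcal N,\widetilde{\mathcal N})\big),\qquad \widetilde{\mathcal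 N}(\omega_{AB})=\mathcal P(\omega_{AB}\otimes\rho_{\hat A\hat B}).$$ Let $\Gamma^{\mathcal N}_{ABA'B'}=(\mathrm{id}\otimes\mathcal N)(|\Gamma\rangle\!\langle\Gamma|)$, with $|\Gamma\rangle=\sum_i|i\rangle|i\rangle$, be the Choi operator of $\mathcal N$, and write $\operatorname{Re}[X]=\tfrac12(X+X^\dagger)$. Then $$e^F_{\mathrm{PPT}}(\mathcal N,\rho_{\hat A\hat B})=1-\Big[\sup_{\lambda\ge 0,\;P_{AB\hat A\hat BA'B'}\ge 0,\;Q_{ABA'B'}}\lambda\Big]^2,$$ where $\lambda$ is real, $P$ and $Q$ are linear operators on the indicated systems, and the supremum is subject to $$\lambda I_{AB}\le\operatorname{Re}\big[\operatorname{Tr}_{A'B'}[Q_{ABA'B'}]\big],\qquad T_{B\hat BB'}(P_{AB\hat A\hat BA'B'})\ge0,\qquad \operatorname{Tr}_{A'B'}[P_{AB\hat A\hat BA'B'}]=I_{AB\hat A\hat B},$$ $$\begin{bmatrix}\Gamma^{\mathcal N}_{ABA'B'}&Q^\dagger_{ABA'B'}\\ Q_{ABA'B'}&\operatorname{Tr}_{\hat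 A\hat B}[T_{\hat A\hat B}(\rho_{\hat A\hat B})P_{AB\hat A\hat BA'B'}]\end{bmatrix}\ge0 .$$ Moreover, the constraints are feasible and the feasible values of $\lambda$ are bounded above, so that the supremum is a real number. -/

import Mathlib

open scoped MatrixOrder ComplexOrder ComplexStarModule Kronecker

noncomputable section

namespace BipartiteSim

/-- A finite-dimensional quantum system is given by the finite type indexing its orthonormal basis;
operators on it are complex matrices, and composite systems are indexed by product types. -/
abbrev Op (c : Type*) : Type _ := Matrix c c ℂ

/-- Quantum states (density operators): positive semi-definite with trace one. -/
structure IsState {c : Type*} [Fintype c] (ρ : Op c) : Prop where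
  posSemidef : ρ.PosSemidef
  trace_eq_one : ρ.trace = 1

/-- The trace norm `‖X‖₁ = Tr |X|`, where `|X| = √(X† X)`. -/
def traceNorm {c : Type*} [Fintype c] [DecidableEq c] (X : Op c) : ℝ :=
  (CFC.sqrt (X.conjTranspose * X)).trace.re

/-- The fidelity `F(ω, τ) = ‖√ω √τ‖₁²`. -/
def fidelity {c : Type*} [Fintype c] [DecidableEq c] (ω τ : Op c) : ℝ :=
  traceNorm (CFC.sqrt ω * CFC.sqrt τ) ^ 2

/-- The action of `id_R ⊗ Φ` on operators of the composite system `RC`: the map `Φ` is applied to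
every block `⟨i|_R X |j⟩_R`. -/
def idTensor (r : Type*) {c d : Type*} (Φ : Op c →ₗ[ℂ] Op d) (X : Op (r × c)) : Op (r × d) :=
  Matrix.of fun x y => Φ (Matrix.of fun i j => X (x.1, i) (y.1, j)) x.2 y.2

/-- Complete positivity: `id_R ⊗ Φ` preserves positive semi-definiteness for every
finite-dimensional reference system `R`. -/
def IsCompletelyPositive {c d : Type*} [Fintype c] [Fintype d] (Φ : Op c →ₗ[ℂ] Op d) : Prop :=
  ∀ (k : ℕ) (X : Op (Fin k × c)), X.PosSemidef → (idTensor (Fin k) Φ X).PosSemidef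

/-- Quantum channels: completely positive trace-preserving linear maps. -/
structure IsChannel {c d : Type*} [Fintype c] [Fintype d] (Φ : Op c →ₗ[ℂ] Op d) : Prop where
  completelyPositive : IsCompletelyPositive Φ
  tracePreserving : ∀ X : Op c, (Φ X).trace = X.trace

/-- The channel fidelity `F(N, M) = inf_{ρ_{RC}} F(N(ρ_{RC}), M(ρ_{RC}))`, the infimum being over
all states `ρ_{RC}` with a reference system `R` of arbitrary finite dimension. -/
def channelFidelity {c d : Type*} [Fintype c] [Fintype d] [DecidableEq d]
    (N M : Op c →ₗ[ℂ] Op d) : ℝ :=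
  sInf {f : ℝ | ∃ (k : ℕ) (ρ : Op (Fin k × c)), IsState ρ ∧
    f = fidelity (idTensor (Fin k) N ρ) (idTensor (Fin k) M ρ)}

/-- The unnormalized maximally entangled vector `|Γ⟩_{RC} = ∑ i, |i⟩_R |i⟩_C`. -/
def maxEntVec (c : Type*) [DecidableEq c] : c × c → ℂ := fun x => if x.1 = x.2 then 1 else 0

/-- The operator `Γ_{RC} = |Γ⟩⟨Γ|_{RC}`. -/
def maxEnt (c : Type*) [DecidableEq c] : Op (c × c) :=
  Matrix.vecMulVec (maxEntVec c) (star (maxEntVec c))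

/-- The Choi operator `Γ_{RD}^N = (id_R ⊗ N)(Γ_{RC})`. -/
def choi {c d : Type*} [DecidableEq c] (N : Op c →ₗ[ℂ] Op d) : Op (c × d) :=
  idTensor c N (maxEnt c)

/-- The partial trace over the first tensor factor. -/
def traceFst {c d : Type*} [Fintype c] (X : Op (c × d)) : Op d :=
  Matrix.of fun i j => ∑ k, X (k, i) (k, j)

/-- The partial trace over the second tensor factor. -/
def traceSnd {c d : Type*} [Fintype d] (X : Op (c × d)) : Op c :=
  Matrix.of fun i j => ∑ k, X (i, k) (j, k)

/-- The partial transpose `id ⊗ T` on the second tensor factor. -/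
def transposeSnd (c d : Type*) : Op (c × d) →ₗ[ℂ] Op (c × d) where
  toFun X := Matrix.of fun x y => X (x.1, y.2) (y.1, x.2)
  map_add' _ _ := rfl
  map_smul' _ _ := rfl

/-- Relabelling of four systems `(12)(34)` as `(13)(24)`. -/
def regroup {c₁ c₂ c₃ c₄ : Type*} (X : Op ((c₁ × c₂) × (c₃ × c₄))) :
    Op ((c₁ × c₃) × (c₂ × c₄)) :=
  Matrix.reindex (Equiv.prodProdProdComm c₁ c₂ c₃ c₄) (Equiv.prodProdProdComm c₁ c₂ c₃ c₄) X

/-- A bipartite map `P_{AB → A'B'}` is a C-PPT-P channel if it is a quantum channel and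
`T_{B'} ∘ P ∘ T_B` is completely positive. -/
structure IsCPPTP {a b a' b' : Type*} [Fintype a] [Fintype b] [Fintype a'] [Fintype b']
    (P : Op (a × b) →ₗ[ℂ] Op (a' × b')) : Prop where
  channel : IsChannel P
  ppt : IsCompletelyPositive (transposeSnd a' b' ∘ₗ P ∘ₗ transposeSnd a b)

/-- The simulation `ω_{AB} ↦ P(ω_{AB} ⊗ ρ_{ÂB̂})`. The bipartite map `P` has Alice's input `AÂ` and
Bob's input `BB̂`. -/
def simulate {a b ah bh a' b' : Type*} (ρ : Op (ah × bh))
    (P : Op ((a × ah) × (b × bh)) →ₗ[ℂ] Op (a' × b')) : Op (a × b) →ₗ[ℂ] Op (a' × b') where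
  toFun ω := P (regroup (ω ⊗ₖ ρ))
  map_add' ω₁ ω₂ := by rw [Matrix.add_kronecker, ← map_add]; rfl
  map_smul' z ω := by rw [Matrix.smul_kronecker, RingHom.id_apply, ← map_smul]; rfl

/-- The simulation error of `N` with resource state `ρ`, minimized over all C-PPT-P channels and
measured by the channel infidelity. -/
def errPPT {a b ah bh a' b' : Type*} [Fintype a] [Fintype b] [Fintype ah] [Fintype bh]
    [Fintype a'] [Fintype b'] [DecidableEq a'] [DecidableEq b']
    (N : Op (a × b) →ₗ[ℂ] Op (a' × b')) (ρ : Op (ah × bh)) : ℝ :=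
  sInf {e : ℝ | ∃ P : Op ((a × ah) × (b × bh)) →ₗ[ℂ] Op (a' × b'), IsCPPTP P ∧
    e = 1 - channelFidelity N (simulate ρ P)}

/-- The relabelling of the systems `(AÂ)(BB̂)(A'B')` as `(ÂB̂)((AB)(A'B'))`. -/
def resourceFirst (a b ah bh a' b' : Type*) :
    ((a × ah) × (b × bh)) × (a' × b') ≃ (ah × bh) × ((a × b) × (a' × b')) where
  toFun x := ((x.1.1.2, x.1.2.2), ((x.1.1.1, x.1.2.1), x.2))
  invFun y := (((y.2.1.1, y.1.1), (y.2.1.2, y.1.2)), y.2.2)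
  left_inv _ := rfl
  right_inv _ := rfl

/-- The operator `Tr_{ÂB̂}[T_{ÂB̂}(ρ_{ÂB̂}) P_{ABÂB̂A'B'}]` on `ABA'B'`. -/
def contractResource {a b ah bh a' b' : Type*} [Fintype a] [Fintype b] [Fintype ah] [Fintype bh]
    [Fintype a'] [Fintype b'] [DecidableEq a] [DecidableEq b] [DecidableEq a'] [DecidableEq b']
    (ρ : Op (ah × bh)) (P : Op (((a × ah) × (b × bh)) × (a' × b'))) :
    Op ((a × b) × (a' × b')) :=
  traceFst ((ρ.transpose ⊗ₖ (1 : Op ((a × b) × (a' × b')))) *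
    Matrix.reindex (resourceFirst a b ah bh a' b') (resourceFirst a b ah bh a' b') P)

/-- The constraints of the semi-definite program on the variables `lam`, `P` and `Q`. Inequalities
between operators refer to the Loewner order, and `ℜ X = (X + X†) / 2`. -/
structure IsFeasible {a b ah bh a' b' : Type*} [Fintype a] [Fintype b] [Fintype ah] [Fintype bh]
    [Fintype a'] [Fintype b'] [DecidableEq a] [DecidableEq b] [DecidableEq ah] [DecidableEq bh]
    [DecidableEq a'] [DecidableEq b']
    (N : Op (a × b) →ₗ[ℂ] Op (a' × b')) (ρ : Op (ah × bh)) (lam : ℝ)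
    (P : Op (((a × ah) × (b × bh)) × (a' × b'))) (Q : Op ((a × b) × (a' × b'))) : Prop where
  lam_nonneg : 0 ≤ lam
  posSemidef : P.PosSemidef
  lam_le : (lam : ℂ) • (1 : Op (a × b)) ≤ (ℜ (traceSnd Q) : Op (a × b))
  /-- `T_{BB̂B'}(P) ≥ 0`, with the systems of Alice and those of Bob grouped together. -/
  ppt : (transposeSnd ((a × ah) × a') ((b × bh) × b') (regroup P)).PosSemidef
  tracePreserving : traceSnd P = 1
  block : (Matrix.fromBlocks (choi N) Q.conjTranspose Q (contractResource ρ P)).PosSemidef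

/-- The set of objective values `lam` attained at feasible points of the semi-definite program. -/
def feasibleValues {a b ah bh a' b' : Type*} [Fintype a] [Fintype b] [Fintype ah] [Fintype bh]
    [Fintype a'] [Fintype b'] [DecidableEq a] [DecidableEq b] [DecidableEq ah] [DecidableEq bh]
    [DecidableEq a'] [DecidableEq b']
    (N : Op (a × b) →ₗ[ℂ] Op (a' × b')) (ρ : Op (ah × bh)) : Set ℝ :=
  {lam : ℝ | ∃ (P : Op (((a × ah) × (b × bh)) × (a' × b'))) (Q : Op ((a × b) × (a' × b'))),
    IsFeasible N ρ lam P Q}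

end BipartiteSim

end

/-!
Completely positive maps correspond to their positive semi-definite Choi operators, and under this
correspondence the variable `P` of the semi-definite program runs over the C-PPT-P channels, with
`Tr_{ÂB̂}[T(ρ) P]` the Choi operator of the simulated map. It remains to show that, for completely
positive `N` and `M`, the largest `λ` with `λ I ≤ Re[Tr_D Q]` for some `Q` such that
`[[Γ^N, Q†], [Q, Γ^M]] ≥ 0` is the root fidelity `√F(N, M)`.

Such a block operator is positive semi-definite exactly when `Q = √Γ^M V √Γ^N` for a contraction
`V`. Applying a block operator to an input state gives a block operator on the outputs, whose
off-diagonal trace is at most the root fidelity of the outputs since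
`‖X‖₁ = max {Re Tr[V X] : ‖V‖ ≤ 1}`; this bounds `λ` by `√F(N, M)`. Conversely,
`Re Tr[(σ ⊗ I) √Γ^M V √Γ^N]` is bilinear in the input marginal `σ` and the contraction `V`, and for
each `σ` its maximum over `V` is the root fidelity of the outputs on a purification of `σ`, hence at
least `√F(N, M)`. By the minimax theorem a single `V` achieves this for all `σ` at once, which says
that `Re[Tr_D Q] ≥ √F(N, M) I`.
-/

namespace BipartiteSim

open Matrix
open scoped Matrix.Norms.L2Operator

section Contractions

variable {l m n : Type*} [Fintype l] [Fintype m] [Fintype n]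

theorem exists_eq_conjTranspose_mul_self {A : Op n} (hA : A.PosSemidef) :
    ∃ C : Op n, A = Cᴴ * C := by
  classical
  exact CStarAlgebra.nonneg_iff_eq_star_mul_self.1 hA.nonneg

theorem sqrt_isHermitian [DecidableEq n] (A : Op n) : (CFC.sqrt A)ᴴ = CFC.sqrt A :=
  (CFC.sqrt_nonneg A).isSelfAdjoint

theorem conjTranspose_sqrt_mul_sqrt [DecidableEq n] {A : Op n} (hA : A.PosSemidef) :
    (CFC.sqrt A)ᴴ * CFC.sqrt A = A := by
  rw [sqrt_isHermitian, CFC.sqrt_mul_sqrt_self A hA.nonneg]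

theorem exists_isHermitian_mul_mul_self_eq {A : Op n} (hA : A.IsHermitian) :
    ∃ G : Op n, G.IsHermitian ∧ A * G * A = A := by
  classical
  have hcont (f : ℝ → ℝ) : ContinuousOn f (spectrum ℝ A) := A.finite_real_spectrum.continuousOn f
  have hid : cfc (fun x : ℝ => x) A = A := cfc_id' ℝ A hA
  have hmul (f g : ℝ → ℝ) : cfc f A * cfc g A = cfc (fun x => f x * g x) A :=
    (cfc_mul f g A (hcont f) (hcont g)).symm
  refine ⟨cfc (fun x : ℝ => x⁻¹) A, cfc_predicate _ A, ?_⟩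
  calc A * cfc (fun x : ℝ => x⁻¹) A * A = cfc (fun x : ℝ => x * x⁻¹ * x) A := by
        rw [← hmul, ← hmul, hid]
    _ = A := by simp only [mul_inv_mul_cancel, hid]

theorem mul_mul_eq_self_of_conjTranspose_mul_self_le {B : Matrix l n ℂ} {P G : Op n}
    (hB : Bᴴ * B ≤ P) (hP : P.IsHermitian) (hG : G.IsHermitian) (hPGP : P * G * P = P) :
    B * G * P = B := by
  classical
  have hzero : (G * P - 1)ᴴ * P * (G * P - 1) = 0 := by
    simp only [conjTranspose_sub, conjTranspose_mul, conjTranspose_one, hP.eq, hG.eq,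
      Matrix.sub_mul, Matrix.mul_sub, Matrix.mul_one, Matrix.one_mul, ← Matrix.mul_assoc, hPGP]
    abel
  have hle : (B * (G * P - 1))ᴴ * (B * (G * P - 1)) ≤ 0 := by
    rw [← hzero, conjTranspose_mul, Matrix.mul_assoc, ← Matrix.mul_assoc Bᴴ, ← Matrix.mul_assoc]
    exact star_left_conjugate_le_conjugate hB _
  have h := conjTranspose_mul_self_eq_zero.1
    (hle.antisymm (posSemidef_conjTranspose_mul_self _).nonneg)
  rwa [Matrix.mul_sub, Matrix.mul_one, sub_eq_zero, ← Matrix.mul_assoc] at h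

theorem norm_le_one_of_conjTranspose_mul_self_le [DecidableEq n] {V : Matrix m n ℂ}
    (h : Vᴴ * V ≤ 1) : ‖V‖ ≤ 1 := by
  classical
  have h1 := (CStarAlgebra.norm_le_one_iff_of_nonneg (Vᴴ * V)
    (posSemidef_conjTranspose_mul_self V).nonneg).2 h
  rw [l2_opNorm_conjTranspose_mul_self] at h1
  nlinarith [norm_nonneg V]

omit [Fintype n] in
-- The factor is `V = B P⁺ Aᴴ` with `P = Aᴴ A`, and `Vᴴ V` lies below the projection `A P⁺ Aᴴ`.
theorem exists_norm_le_one_mul_eq [Finite n] [DecidableEq m] {A : Matrix m n ℂ}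
    {B : Matrix l n ℂ} (h : Bᴴ * B ≤ Aᴴ * A) : ∃ V : Matrix l m ℂ, ‖V‖ ≤ 1 ∧ V * A = B := by
  have := Fintype.ofFinite n
  have hP := isHermitian_conjTranspose_mul_self A
  obtain ⟨G, hG, hPGP⟩ := exists_isHermitian_mul_mul_self_eq hP
  have hBG := mul_mul_eq_self_of_conjTranspose_mul_self_le h hP hG hPGP
  have hAG := mul_mul_eq_self_of_conjTranspose_mul_self_le le_rfl hP hG hPGP
  have hproj : IsStarProjection (A * G * Aᴴ) :=
    ⟨by rw [IsIdempotentElem, ← Matrix.mul_assoc, ← Matrix.mul_assoc, Matrix.mul_assoc _ Aᴴ, hAG],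
      by rw [IsSelfAdjoint, star_eq_conjTranspose, conjTranspose_mul, conjTranspose_mul,
        conjTranspose_conjTranspose, hG.eq, Matrix.mul_assoc]⟩
  have hmono : (G * Aᴴ)ᴴ * (Bᴴ * B) * (G * Aᴴ) ≤ (G * Aᴴ)ᴴ * (Aᴴ * A) * (G * Aᴴ) := by
    rw [← sub_nonneg, ← Matrix.sub_mul, ← Matrix.mul_sub]
    exact ((le_iff.1 h).conjTranspose_mul_mul_same _).nonneg
  refine ⟨B * G * Aᴴ, norm_le_one_of_conjTranspose_mul_self_le ?_, by rwa [Matrix.mul_assoc]⟩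
  calc (B * G * Aᴴ)ᴴ * (B * G * Aᴴ) = (G * Aᴴ)ᴴ * (Bᴴ * B) * (G * Aᴴ) := by
        simp only [conjTranspose_mul, Matrix.mul_assoc]
    _ ≤ (G * Aᴴ)ᴴ * (Aᴴ * A) * (G * Aᴴ) := hmono
    _ = A * G * Aᴴ * (A * G * Aᴴ) := by
        simp only [conjTranspose_mul, conjTranspose_conjTranspose, hG.eq, Matrix.mul_assoc]
    _ = A * G * Aᴴ := hproj.isIdempotentElem
    _ ≤ 1 := hproj.le_one

theorem norm_mul_le_one [DecidableEq m] [DecidableEq n] {V : Matrix l m ℂ}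
    {W : Matrix m n ℂ} (hV : ‖V‖ ≤ 1) (hW : ‖W‖ ≤ 1) : ‖V * W‖ ≤ 1 := by
  classical
  exact (l2_opNorm_mul V W).trans (mul_le_one₀ hV (norm_nonneg W) hW)

theorem norm_conjTranspose_le_one [DecidableEq m] [DecidableEq n] {V : Matrix m n ℂ}
    (hV : ‖V‖ ≤ 1) : ‖Vᴴ‖ ≤ 1 :=
  (l2_opNorm_conjTranspose V).trans_le hV

end Contractions

section Trace

variable {m n : Type*} [Fintype m] [Fintype n]

theorem re_trace_nonneg {A : Op n} (hA : A.PosSemidef) : 0 ≤ A.trace.re :=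
  (Complex.nonneg_iff.1 hA.trace_nonneg).1

theorem re_trace_mul_nonneg {A B : Op n} (hA : A.PosSemidef) (hB : B.PosSemidef) :
    0 ≤ (A * B).trace.re := by
  obtain ⟨C, rfl⟩ := exists_eq_conjTranspose_mul_self hB
  rw [← Matrix.mul_assoc, trace_mul_comm, ← Matrix.mul_assoc]
  exact re_trace_nonneg (hA.mul_mul_conjTranspose_same C)

theorem re_trace_mul_conjTranspose {A : Op n} (hA : A.IsHermitian) (X : Op n) :
    (A * Xᴴ).trace.re = (A * X).trace.re := by
  rw [← Complex.conj_re (A * X).trace, ← Complex.star_def, ← trace_conjTranspose,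
    conjTranspose_mul, hA.eq, trace_mul_comm]

theorem re_trace_mul_realPart {A : Op n} (hA : A.IsHermitian) (X : Op n) :
    (A * (ℜ X : Op n)).trace.re = (A * X).trace.re := by
  rw [realPart_apply_coe, star_eq_conjTranspose, mul_smul_comm, Matrix.mul_add, trace_smul,
    trace_add, Complex.smul_re, Complex.add_re, re_trace_mul_conjTranspose hA, smul_eq_mul]
  ring

theorem re_trace_mul_le_of_norm_le_one [DecidableEq n] {W A : Op n} (hW : ‖W‖ ≤ 1)
    (hA : A.PosSemidef) : (W * A).trace.re ≤ A.trace.re := by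
  have hle : (ℜ W : Op n) ≤ 1 := by
    refine ((ℜ W).2.le_algebraMap_norm_self).trans ?_
    rw [← map_one (algebraMap ℝ (Op n))]
    exact algebraMap_mono _ ((realPart.norm_le W).trans hW)
  have h := re_trace_mul_nonneg hA (le_iff.1 hle)
  rw [Matrix.mul_sub, Matrix.mul_one, trace_sub, Complex.sub_re,
    re_trace_mul_realPart hA.isHermitian, trace_mul_comm] at h
  exact sub_nonneg.1 h

theorem traceNorm_nonneg [DecidableEq n] (X : Op n) : 0 ≤ traceNorm X :=
  re_trace_nonneg (nonneg_iff_posSemidef.1 (CFC.sqrt_nonneg (Xᴴ * X)))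

theorem re_trace_mul_le_traceNorm [DecidableEq n] {V : Op n} (hV : ‖V‖ ≤ 1) (X : Op n) :
    (V * X).trace.re ≤ traceNorm X := by
  obtain ⟨U, hU, hUX⟩ := exists_norm_le_one_mul_eq
    (conjTranspose_sqrt_mul_sqrt (posSemidef_conjTranspose_mul_self X)).ge
  rw [← hUX, ← Matrix.mul_assoc, hUX]
  exact re_trace_mul_le_of_norm_le_one (norm_mul_le_one hV hU)
    (nonneg_iff_posSemidef.1 (CFC.sqrt_nonneg (Xᴴ * X)))

theorem exists_re_trace_mul_eq_traceNorm [DecidableEq n] (X : Op n) :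
    ∃ V : Op n, ‖V‖ ≤ 1 ∧ (V * X).trace.re = traceNorm X := by
  obtain ⟨V, hV, hVX⟩ := exists_norm_le_one_mul_eq
    (conjTranspose_sqrt_mul_sqrt (posSemidef_conjTranspose_mul_self X)).le
  exact ⟨V, hV, by rw [hVX, traceNorm]⟩

theorem traceNorm_sqrt_mul_sqrt_le [DecidableEq m] [DecidableEq n] (A B : Matrix m n ℂ) :
    traceNorm (CFC.sqrt (Aᴴ * A) * CFC.sqrt (Bᴴ * B)) ≤ traceNorm (A * Bᴴ) := by
  obtain ⟨V, hV, hVA⟩ := exists_norm_le_one_mul_eq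
    (conjTranspose_sqrt_mul_sqrt (posSemidef_conjTranspose_mul_self A)).le
  obtain ⟨W, hW, hWB⟩ := exists_norm_le_one_mul_eq
    (conjTranspose_sqrt_mul_sqrt (posSemidef_conjTranspose_mul_self B)).le
  obtain ⟨U, hU, hUtr⟩ := exists_re_trace_mul_eq_traceNorm
    (CFC.sqrt (Aᴴ * A) * CFC.sqrt (Bᴴ * B))
  calc traceNorm (CFC.sqrt (Aᴴ * A) * CFC.sqrt (Bᴴ * B))
      = (U * (V * A * (W * B)ᴴ)).trace.re := by rw [hVA, hWB, sqrt_isHermitian (Bᴴ * B), hUtr]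
    _ = (Wᴴ * (U * V) * (A * Bᴴ)).trace.re := by
        rw [trace_mul_comm, conjTranspose_mul, trace_mul_comm]
        simp only [Matrix.mul_assoc]
        rw [trace_mul_comm Wᴴ]
        simp only [Matrix.mul_assoc]
    _ ≤ traceNorm (A * Bᴴ) := re_trace_mul_le_traceNorm
        (norm_mul_le_one (norm_conjTranspose_le_one hW) (norm_mul_le_one hU hV)) _

end Trace

section Block

variable {m n : Type*} [Fintype m] [Fintype n]

theorem fromBlocks_one_posSemidef [DecidableEq m] [DecidableEq n] {V : Matrix n m ℂ}
    (hV : ‖V‖ ≤ 1) : (fromBlocks 1 Vᴴ V 1).PosSemidef := by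
  have h : ‖V * Vᴴ‖ ≤ 1 := norm_mul_le_one hV (norm_conjTranspose_le_one hV)
  rw [CStarAlgebra.norm_le_one_iff_of_nonneg _ (posSemidef_self_mul_conjTranspose V).nonneg] at h
  let : Invertible (1 : Op m) := invertibleOne
  have h1 := (PosDef.fromBlocks₁₁ (A := (1 : Op m)) Vᴴ (1 : Op n) PosDef.one).2
  rw [conjTranspose_conjTranspose, inv_one, Matrix.mul_one] at h1
  exact h1 (le_iff.1 h)

theorem fromBlocks_posSemidef_iff [DecidableEq m] [DecidableEq n] {ω : Op m} {τ : Op n}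
    {X : Matrix n m ℂ} :
    (fromBlocks ω Xᴴ X τ).PosSemidef ↔ ω.PosSemidef ∧ τ.PosSemidef ∧
      ∃ V : Matrix n m ℂ, ‖V‖ ≤ 1 ∧ X = CFC.sqrt τ * V * CFC.sqrt ω := by
  constructor
  · intro h
    have hω : ω.PosSemidef := h.submatrix Sum.inl
    have hτ : τ.PosSemidef := h.submatrix Sum.inr
    obtain ⟨C, hC⟩ := exists_eq_conjTranspose_mul_self h
    obtain ⟨V, hV, hVω⟩ := exists_norm_le_one_mul_eq (B := C.submatrix id Sum.inl)
      ((congrArg toBlocks₁₁ hC).symm.trans (conjTranspose_sqrt_mul_sqrt hω).symm).le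
    obtain ⟨W, hW, hWτ⟩ := exists_norm_le_one_mul_eq (B := C.submatrix id Sum.inr)
      ((congrArg toBlocks₂₂ hC).symm.trans (conjTranspose_sqrt_mul_sqrt hτ).symm).le
    refine ⟨hω, hτ, Wᴴ * V, norm_mul_le_one (norm_conjTranspose_le_one hW) hV, ?_⟩
    calc X = (C.submatrix id Sum.inr)ᴴ * C.submatrix id Sum.inl := congrArg toBlocks₂₁ hC
      _ = CFC.sqrt τ * (Wᴴ * V) * CFC.sqrt ω := by
        rw [← hVω, ← hWτ, conjTranspose_mul, sqrt_isHermitian]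
        simp only [Matrix.mul_assoc]
  · rintro ⟨hω, hτ, V, hV, rfl⟩
    have h := (fromBlocks_one_posSemidef hV).conjTranspose_mul_mul_same
      (fromBlocks (CFC.sqrt ω) 0 0 (CFC.sqrt τ))
    simpa [fromBlocks_conjTranspose, fromBlocks_multiply, sqrt_isHermitian,
      CFC.sqrt_mul_sqrt_self ω hω.nonneg, CFC.sqrt_mul_sqrt_self τ hτ.nonneg,
      Matrix.mul_assoc] using h

theorem re_trace_le_traceNorm_of_fromBlocks_posSemidef [DecidableEq n] {ω τ X : Op n}
    (h : (fromBlocks ω Xᴴ X τ).PosSemidef) :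
    X.trace.re ≤ traceNorm (CFC.sqrt ω * CFC.sqrt τ) := by
  obtain ⟨-, -, V, hV, rfl⟩ := fromBlocks_posSemidef_iff.1 h
  rw [Matrix.mul_assoc, trace_mul_comm, Matrix.mul_assoc]
  exact re_trace_mul_le_traceNorm hV _

theorem two_mul_re_trace_le_of_fromBlocks_posSemidef {ω τ X : Op n}
    (h : (fromBlocks ω Xᴴ X τ).PosSemidef) : 2 * X.trace.re ≤ ω.trace.re + τ.trace.re := by
  classical
  let R : Matrix (n ⊕ n) n ℂ := fromRows 1 (-1)
  have h1 := re_trace_nonneg (h.conjTranspose_mul_mul_same R)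
  have h2 : Rᴴ * fromBlocks ω Xᴴ X τ * R = ω - Xᴴ - X + τ := by
    simp only [R, conjTranspose_fromRows_eq_fromCols_conjTranspose, conjTranspose_one,
      conjTranspose_neg, Matrix.mul_assoc, fromBlocks_mul_fromRows, mul_one, mul_neg,
      fromCols_mul_fromRows, one_mul, neg_mul, neg_add_rev, neg_neg]
    abel
  have h3 : (Xᴴ).trace.re = X.trace.re := by rw [trace_conjTranspose]; rfl
  rw [h2, trace_add, trace_sub, trace_sub, Complex.add_re, Complex.sub_re, Complex.sub_re, h3] at h1
  linarith

end Block

section States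

variable {m n : Type*} [Fintype m] [Fintype n]

theorem isState_inv_trace_smul {T : Op n} (hT : T.PosSemidef) (h0 : T ≠ 0) :
    IsState (T.trace⁻¹ • T) :=
  ⟨hT.smul (inv_nonneg.2 hT.trace_nonneg), by
    rw [trace_smul, smul_eq_mul, inv_mul_cancel₀ (mt hT.trace_eq_zero_iff.1 h0)]⟩

theorem exists_isState [Nonempty n] : ∃ σ : Op n, IsState σ := by
  classical exact ⟨_, isState_inv_trace_smul PosSemidef.one one_ne_zero⟩

theorem convex_setOfPred_isState : Convex ℝ {σ : Op n | IsState σ} := by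
  intro σ hσ τ hτ p q hp hq hpq
  refine ⟨(hσ.posSemidef.smul hp).add (hτ.posSemidef.smul hq), ?_⟩
  rw [trace_add, trace_smul, trace_smul, hσ.trace_eq_one, hτ.trace_eq_one, ← add_smul, hpq,
    one_smul]

theorem trace_conjTranspose_mul_self_eq_norm_sq (x : EuclideanSpace ℂ (m × n)) :
    ((of (Function.curry x))ᴴ * of (Function.curry x)).trace = (‖x‖ ^ 2 : ℝ) := by
  simp only [EuclideanSpace.norm_sq_eq, Fintype.sum_prod_type, Matrix.trace, diag_apply,
    Matrix.mul_apply, conjTranspose_apply, of_apply, Function.curry_apply, Complex.star_def,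
    Complex.conj_mul', Complex.ofReal_sum, Complex.ofReal_pow]
  exact Finset.sum_comm

theorem isCompact_setOfPred_isState : IsCompact {σ : Op n | IsState σ} := by
  let f (x : EuclideanSpace ℂ (n × n)) : Op n := (of (Function.curry x))ᴴ * of (Function.curry x)
  have hf : Continuous f := by
    have h : Continuous fun x : EuclideanSpace ℂ (n × n) => (of (Function.curry x) : Op n) :=
      continuous_matrix fun i j => by simpa using (EuclideanSpace.proj (i, j)).continuous
    exact h.matrix_conjTranspose.matrix_mul h
  suffices {σ : Op n | IsState σ} = f '' Metric.sphere 0 1 from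
    this ▸ (isCompact_sphere 0 1).image hf
  ext σ
  constructor
  · rintro ⟨hσ, htr⟩
    obtain ⟨C, rfl⟩ := exists_eq_conjTranspose_mul_self hσ
    let x : EuclideanSpace ℂ (n × n) := WithLp.toLp 2 fun z => C z.1 z.2
    have hx : ‖x‖ ^ 2 = 1 := by
      exact_mod_cast (trace_conjTranspose_mul_self_eq_norm_sq x).symm.trans htr
    exact ⟨x, by simpa using (pow_eq_one_iff_of_nonneg (norm_nonneg x) two_ne_zero).1 hx, rfl⟩
  · rintro ⟨x, hx, rfl⟩
    refine ⟨posSemidef_conjTranspose_mul_self _, ?_⟩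
    rw [trace_conjTranspose_mul_self_eq_norm_sq, mem_sphere_zero_iff_norm.1 hx]
    simp

theorem posSemidef_iff_forall_isState {H : Op n} (hH : H.IsHermitian) :
    H.PosSemidef ↔ ∀ σ : Op n, IsState σ → 0 ≤ (σ * H).trace.re := by
  refine ⟨fun h σ hσ => re_trace_mul_nonneg hσ.posSemidef h, fun h => ?_⟩
  refine PosSemidef.of_dotProduct_mulVec_nonneg hH fun v => ?_
  have hT : (vecMulVec v (star v)).PosSemidef := posSemidef_vecMulVec_self_star v
  have htr : star v ⬝ᵥ H *ᵥ v = (vecMulVec v (star v) * H).trace := by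
    rw [trace_mul_comm, mul_vecMulVec, trace_vecMulVec, dotProduct_comm]
  refine Complex.nonneg_iff.2 ⟨?_, (hH.im_star_dotProduct_mulVec_self v).symm⟩
  rw [htr]
  obtain h0 | h0 := eq_or_ne (vecMulVec v (star v)) 0
  · simp [h0]
  have hre := h _ (isState_inv_trace_smul hT h0)
  obtain ⟨t, ht, htT⟩ := RCLike.pos_iff_exists_ofReal.1
    (hT.trace_nonneg.lt_of_ne' (mt hT.trace_eq_zero_iff.1 h0))
  rw [← htT, smul_mul_assoc, trace_smul, smul_eq_mul, RCLike.ofReal_eq_complex_ofReal,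
    ← Complex.ofReal_inv, Complex.re_ofReal_mul] at hre
  exact nonneg_of_mul_nonneg_right hre (inv_pos.2 ht)

theorem smul_one_le_realPart_iff [DecidableEq n] {lam : ℝ} {X : Op n} :
    (lam : ℂ) • (1 : Op n) ≤ (ℜ X : Op n) ↔
      ∀ σ : Op n, IsState σ → lam ≤ (σ * X).trace.re := by
  have hH : ((ℜ X : Op n) - (lam : ℂ) • 1).IsHermitian := by
    refine IsHermitian.sub (ℜ X).2 ?_
    rw [IsHermitian, conjTranspose_smul, conjTranspose_one, Complex.star_def, Complex.conj_ofReal]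
  rw [le_iff, posSemidef_iff_forall_isState hH]
  refine forall₂_congr fun σ hσ => ?_
  rw [Matrix.mul_sub, trace_sub, Complex.sub_re, re_trace_mul_realPart hσ.posSemidef.isHermitian,
    mul_smul_comm, Matrix.mul_one, trace_smul, hσ.trace_eq_one, smul_eq_mul, mul_one,
    Complex.ofReal_re, sub_nonneg]

end States

section Minimax

theorem exists_forall_le_of_forall_exists_le {E F : Type*}
    [AddCommGroup E] [Module ℝ E] [TopologicalSpace E] [IsTopologicalAddGroup E]
    [ContinuousSMul ℝ E] [T2Space E] [FiniteDimensional ℝ E]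
    [AddCommGroup F] [Module ℝ F] [TopologicalSpace F] [IsTopologicalAddGroup F]
    [ContinuousSMul ℝ F] [T2Space F] [FiniteDimensional ℝ F]
    (B : E →ₗ[ℝ] F →ₗ[ℝ] ℝ) {K : Set E} {L : Set F}
    (hK : IsCompact K) (hK' : Convex ℝ K) (hKne : K.Nonempty)
    (hL : IsCompact L) (hL' : Convex ℝ L) (hLne : L.Nonempty)
    {r : ℝ} (h : ∀ x ∈ K, ∃ y ∈ L, r ≤ B x y) :
    ∃ y ∈ L, ∀ x ∈ K, r ≤ B x y := by
  have hcont (x : E) : Continuous (B x) := (B x).continuous_of_finiteDimensional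
  have hcont' (y : F) : Continuous (B.flip y) := (B.flip y).continuous_of_finiteDimensional
  obtain ⟨x₀, hx₀, y₀, hy₀, hsaddle⟩ := Sion.exists_isSaddlePointOn (f := fun x y => B x y)
    hKne hK' hK (fun y _ => (hcont' y).lowerSemicontinuous.lowerSemicontinuousOn _)
    (fun y _ => ((B.flip y).convexOn hK').quasiconvexOn)
    hL' hLne hL (fun x _ => (hcont x).upperSemicontinuous.upperSemicontinuousOn _)
    (fun x _ => ((B x).concaveOn hL').quasiconcaveOn)
  obtain ⟨y, hy, hr⟩ := h x₀ hx₀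
  exact ⟨y₀, hy₀, fun x hx => hr.trans (hsaddle x hx y hy)⟩

end Minimax

section Choi

variable {r s c d : Type*}

/-- The link product `Tr_C[X^{T_C} J]` of operators `X` on `RC` and `J` on `CD`: for the Choi
operator `J` of a map from `C` to `D` it is the image of `X` under that map acting on `C`. -/
def linkProduct [Fintype c] (X : Op (r × c)) (J : Op (c × d)) : Op (r × d) :=
  of fun x y => ∑ i, ∑ j, X (x.1, i) (y.1, j) * J (i, x.2) (j, y.2)

theorem posSemidef_sum_sum [Finite s] [Fintype c] {Y : Op (s × c)} (hY : Y.PosSemidef) :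
    (of fun x y => ∑ i, ∑ j, Y (x, i) (y, j) : Op s).PosSemidef := by
  classical
  have := Fintype.ofFinite s
  let E : Matrix (s × c) s ℂ := (1 : Op s).submatrix Prod.fst id
  convert hY.conjTranspose_mul_mul_same E using 1
  ext x y
  simp only [E, of_apply, Matrix.mul_apply, conjTranspose_apply, submatrix_apply, id,
    Matrix.one_apply, apply_ite star, star_one, star_zero, ite_mul, one_mul, zero_mul, mul_ite,
    mul_one, mul_zero, Fintype.sum_prod_type_right, Finset.sum_ite_eq', Finset.mem_univ, if_true]
  exact Finset.sum_comm

theorem posSemidef_linkProduct [Finite r] [Fintype c] [Finite d] {X : Op (r × c)}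
    {J : Op (c × d)} (hX : X.PosSemidef) (hJ : J.PosSemidef) : (linkProduct X J).PosSemidef := by
  classical
  let f (z : (r × d) × c) : (r × c) × (c × d) := ((z.1.1, z.2), (z.2, z.1.2))
  exact posSemidef_sum_sum (Y := (X ⊗ₖ J).submatrix f f) ((hX.kronecker hJ).submatrix f)

theorem choi_apply [DecidableEq c] (Φ : Op c →ₗ[ℂ] Op d) (i j : c) (x y : d) :
    choi Φ (i, x) (j, y) = Φ (single i j 1) x y := by
  have h : (of fun k l => maxEnt c (i, k) (j, l)) = single i j 1 := by
    ext k l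
    by_cases h1 : i = k <;> by_cases h2 : j = l <;>
      simp [maxEnt, maxEntVec, vecMulVec_apply, single, h1, h2]
  simp only [choi, idTensor, of_apply, h]

variable [Fintype c]

theorem trace_traceSnd [Fintype d] (J : Op (c × d)) : (traceSnd J).trace = J.trace := by
  simp only [Matrix.trace, traceSnd, diag_apply, of_apply, Fintype.sum_prod_type]

variable [DecidableEq c]

theorem apply_eq_sum_choi (Φ : Op c →ₗ[ℂ] Op d) (X : Op c) (x y : d) :
    Φ X x y = ∑ i, ∑ j, X i j * choi Φ (i, x) (j, y) := by
  have h (i j : c) : single i j (X i j) = X i j • single i j (1 : ℂ) := by simp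
  conv_lhs => rw [matrix_eq_sum_single X]
  simp only [h, map_sum, map_smul, Matrix.sum_apply, Matrix.smul_apply, smul_eq_mul, choi_apply]

theorem idTensor_eq_linkProduct (Φ : Op c →ₗ[ℂ] Op d) (X : Op (r × c)) :
    idTensor r Φ X = linkProduct X (choi Φ) := by
  ext x y
  exact apply_eq_sum_choi Φ _ x.2 y.2

theorem isCompletelyPositive_iff_posSemidef_choi [Fintype d] {Φ : Op c →ₗ[ℂ] Op d} :
    IsCompletelyPositive Φ ↔ (choi Φ).PosSemidef := by
  constructor
  · intro h
    let e := Fintype.equivFin c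
    have hΓ : (maxEnt c).PosSemidef := posSemidef_vecMulVec_self_star _
    convert (h _ _ (hΓ.submatrix (Prod.map e.symm id))).submatrix (Prod.map e id) using 1
    ext x y
    simp [choi, idTensor]
  · intro h k X hX
    rw [idTensor_eq_linkProduct]
    exact posSemidef_linkProduct hX h

theorem trace_apply_eq_sum_choi [Fintype d] (Φ : Op c →ₗ[ℂ] Op d) (X : Op c) :
    (Φ X).trace = ∑ i, ∑ j, X i j * traceSnd (choi Φ) i j := by
  simp only [Matrix.trace, diag_apply, apply_eq_sum_choi Φ X, traceSnd, of_apply, Finset.mul_sum]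
  rw [Finset.sum_comm]
  exact Finset.sum_congr rfl fun i _ => Finset.sum_comm

theorem traceSnd_choi_eq_one_iff [Fintype d] {Φ : Op c →ₗ[ℂ] Op d} :
    traceSnd (choi Φ) = 1 ↔ ∀ X, (Φ X).trace = X.trace := by
  constructor
  · intro h X
    rw [trace_apply_eq_sum_choi, h]
    simp [Matrix.one_apply, Matrix.trace]
  · intro h
    ext i j
    have hij : traceSnd (choi Φ) i j = (Φ (single i j 1)).trace := by
      simp only [traceSnd, of_apply, choi_apply, Matrix.trace, diag_apply]
    rw [hij, h, Matrix.one_apply]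
    split_ifs with hij
    · rw [hij, trace_single_eq_same]
    · exact trace_single_eq_of_ne i j 1 hij

theorem isChannel_iff_choi [Fintype d] {Φ : Op c →ₗ[ℂ] Op d} :
    IsChannel Φ ↔ (choi Φ).PosSemidef ∧ traceSnd (choi Φ) = 1 := by
  rw [← isCompletelyPositive_iff_posSemidef_choi, traceSnd_choi_eq_one_iff]
  exact ⟨fun h => ⟨h.1, h.2⟩, fun h => ⟨h.1, h.2⟩⟩

theorem trace_choi [Fintype d] (Φ : Op c →ₗ[ℂ] Op d) : (choi Φ).trace = (Φ 1).trace := by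
  rw [← trace_traceSnd, trace_apply_eq_sum_choi]
  simp [Matrix.one_apply, Matrix.trace]

omit [DecidableEq c] in
theorem IsChannel.nonempty [Fintype d] [Nonempty c] {Φ : Op c →ₗ[ℂ] Op d} (h : IsChannel Φ) :
    Nonempty d := by
  classical
  by_contra hd
  rw [not_nonempty_iff] at hd
  have h1 := h.tracePreserving 1
  rw [Matrix.trace, Fintype.sum_empty, trace_one] at h1
  exact Fintype.card_ne_zero (Nat.cast_eq_zero.1 h1.symm)

/-- The linear map with a given Choi operator. -/
def ofChoi (J : Op (c × d)) : Op c →ₗ[ℂ] Op d where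
  toFun X := of fun x y => ∑ i, ∑ j, X i j * J (i, x) (j, y)
  map_add' X Y := by
    ext x y
    simp [add_mul, Finset.sum_add_distrib]
  map_smul' z X := by
    ext x y
    simp [mul_assoc, Finset.mul_sum]

theorem choi_ofChoi (J : Op (c × d)) : choi (ofChoi J) = J := by
  ext ⟨i, x⟩ ⟨j, y⟩
  rw [choi_apply]
  simp [ofChoi, single, ite_and]

end Choi

section ChannelFidelity

variable {r c d : Type*} [Fintype c]

theorem posSemidef_traceFst {ρ : Op (c × d)} (hρ : ρ.PosSemidef) : (traceFst ρ).PosSemidef := by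
  convert posSemidef_sum Finset.univ fun k (_ : k ∈ Finset.univ) => hρ.submatrix (Prod.mk k) using 1
  ext i j
  simp [traceFst, Matrix.sum_apply]

theorem trace_traceFst [Fintype d] (X : Op (c × d)) : (traceFst X).trace = X.trace := by
  simp only [Matrix.trace, traceFst, diag_apply, of_apply, Fintype.sum_prod_type_right]

theorem linkProduct_fromBlocks_posSemidef [Finite r] [Finite d] {ρ : Op (r × c)}
    (hρ : ρ.PosSemidef) {J J' Q : Op (c × d)} (h : (fromBlocks J Qᴴ Q J').PosSemidef) :
    (fromBlocks (linkProduct ρ J) (linkProduct ρ Q)ᴴ (linkProduct ρ Q)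
      (linkProduct ρ J')).PosSemidef := by
  let f : c × (d ⊕ d) → (c × d) ⊕ (c × d) := fun z => z.2.map (Prod.mk z.1) (Prod.mk z.1)
  let g : (r × d) ⊕ (r × d) → r × (d ⊕ d) := Sum.elim (Prod.map id Sum.inl) (Prod.map id Sum.inr)
  convert (posSemidef_linkProduct hρ (h.submatrix f)).submatrix g using 1
  ext (x | x) (y | y)
  · rfl
  · simp only [linkProduct, conjTranspose_apply, fromBlocks_apply₁₂, submatrix_apply, of_apply, f,
      g, Sum.elim_inl, Sum.elim_inr, Prod.map, Sum.map_inl, Sum.map_inr, star_sum, star_mul']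
    rw [Finset.sum_comm]
    simp only [hρ.isHermitian.apply, id]
  · rfl
  · rfl

theorem trace_linkProduct [Fintype r] [Fintype d] (ρ : Op (r × c)) (J : Op (c × d)) :
    (linkProduct ρ J).trace = ((traceFst ρ)ᵀ * traceSnd J).trace := by
  simp only [Matrix.trace, diag_apply, linkProduct, of_apply, Matrix.mul_apply, traceFst, traceSnd,
    transpose_apply, Fintype.sum_prod_type, Finset.sum_mul_sum]
  simp only [Finset.sum_comm (s := (Finset.univ : Finset d)) (t := (Finset.univ : Finset c)),
    Finset.sum_comm (s := (Finset.univ : Finset r)) (t := (Finset.univ : Finset c))]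
  exact Finset.sum_comm

theorem trace_kronecker_one_mul [Fintype d] [DecidableEq d] (σ : Op c) (Q : Op (c × d)) :
    ((σ ⊗ₖ (1 : Op d)) * Q).trace = (σ * traceSnd Q).trace := by
  simp only [Matrix.trace, diag_apply, Matrix.mul_apply, kroneckerMap_apply, Fintype.sum_prod_type,
    traceSnd, of_apply, Matrix.one_apply, mul_ite, mul_one, mul_zero, ite_mul, zero_mul,
    Finset.sum_ite_eq, Finset.mem_univ, if_true, Finset.mul_sum]
  exact Finset.sum_congr rfl fun i _ => Finset.sum_comm

theorem isState_vecMulVec_vec [Fintype r] {B : Matrix r c ℂ} (hB : (Bᴴ * B).trace = 1) :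
    IsState (vecMulVec (vec Bᵀ) (star (vec Bᵀ))) := by
  refine ⟨posSemidef_vecMulVec_self_star _, ?_⟩
  rw [trace_vecMulVec, dotProduct_comm, star_vec_dotProduct_vec, ← hB, trace_mul_comm Bᴴ,
    ← trace_transpose (B * Bᴴ), transpose_mul]
  rfl

theorem linkProduct_vecMulVec_vec [Fintype d] [DecidableEq d] (B : Matrix r c ℂ) (J : Op (c × d)) :
    linkProduct (vecMulVec (vec Bᵀ) (star (vec Bᵀ))) J =
      (B ⊗ₖ (1 : Op d)) * J * (B ⊗ₖ (1 : Op d))ᴴ := by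
  ext ⟨p, x⟩ ⟨q, y⟩
  simp only [linkProduct, of_apply, vecMulVec_apply, vec, transpose_apply, Matrix.mul_apply,
    kroneckerMap_apply, conjTranspose_apply, Fintype.sum_prod_type, Pi.star_apply,
    Matrix.one_apply, mul_ite, mul_one, mul_zero, ite_mul, zero_mul, Finset.sum_ite_eq,
    Finset.mem_univ, if_true, apply_ite star, star_zero, Finset.sum_mul]
  rw [Finset.sum_comm]
  exact Finset.sum_congr rfl fun i _ => Finset.sum_congr rfl fun j _ => mul_right_comm _ _ _

variable [Fintype d]

theorem channelFidelity_le [DecidableEq d] (N M : Op c →ₗ[ℂ] Op d) {k : ℕ} {ρ : Op (Fin k × c)}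
    (hρ : IsState ρ) :
    channelFidelity N M ≤ fidelity (idTensor (Fin k) N ρ) (idTensor (Fin k) M ρ) :=
  csInf_le ⟨0, by rintro _ ⟨k, ρ, -, rfl⟩; exact sq_nonneg _⟩ ⟨k, ρ, hρ, rfl⟩

theorem channelFidelity_nonneg [DecidableEq d] (N M : Op c →ₗ[ℂ] Op d) : 0 ≤ channelFidelity N M :=
  Real.sInf_nonneg (by rintro _ ⟨k, ρ, -, rfl⟩; exact sq_nonneg _)

variable [DecidableEq c]

/-- The feasible objective values of the semi-definite program for the root fidelity of `N` and `M`: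
maximize `lam` subject to `lam I ≤ Re[Tr_D Q]` and `[[Γ^N, Q†], [Q, Γ^M]] ≥ 0`. -/
def rootFidelityValues (N M : Op c →ₗ[ℂ] Op d) : Set ℝ :=
  {lam | ∃ Q : Op (c × d), (fromBlocks (choi N) Qᴴ Q (choi M)).PosSemidef ∧
    (lam : ℂ) • (1 : Op c) ≤ (ℜ (traceSnd Q) : Op c)}

theorem mem_rootFidelityValues_of_le {N M : Op c →ₗ[ℂ] Op d} {lam mu : ℝ}
    (hmu : mu ∈ rootFidelityValues N M) (h : lam ≤ mu) : lam ∈ rootFidelityValues N M := by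
  obtain ⟨Q, hQ, hle⟩ := hmu
  rw [smul_one_le_realPart_iff] at hle
  exact ⟨Q, hQ, smul_one_le_realPart_iff.2 fun σ hσ => h.trans (hle σ hσ)⟩

variable [DecidableEq d]

-- A purification of `σ` is a trial state for the infimum defining the channel fidelity.
theorem sqrt_channelFidelity_le_traceNorm {N M : Op c →ₗ[ℂ] Op d} (hN : (choi N).PosSemidef)
    (hM : (choi M).PosSemidef) {σ : Op c} (hσ : IsState σ) :
    √(channelFidelity N M) ≤
      traceNorm (CFC.sqrt (choi N) * (σ ⊗ₖ (1 : Op d)) * CFC.sqrt (choi M)) := by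
  obtain ⟨C, hC⟩ := exists_eq_conjTranspose_mul_self hσ.posSemidef
  let B : Matrix (Fin (Fintype.card c)) c ℂ := C.submatrix (Fintype.equivFin c).symm id
  have hB : Bᴴ * B = σ := by
    rw [hC, conjTranspose_submatrix, submatrix_mul_equiv, submatrix_id_id]
  have hBstate := isState_vecMulVec_vec (hB ▸ hσ.trace_eq_one)
  let S := B ⊗ₖ (1 : Op d)
  have hS : Sᴴ * S = σ ⊗ₖ 1 := by
    rw [conjTranspose_kronecker, ← mul_kronecker_mul, hB, conjTranspose_one, Matrix.mul_one]
  have hout {J : Op (c × d)} (hJ : J.PosSemidef) :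
      S * J * Sᴴ = (CFC.sqrt J * Sᴴ)ᴴ * (CFC.sqrt J * Sᴴ) := by
    conv_lhs => rw [← conjTranspose_sqrt_mul_sqrt hJ]
    simp only [conjTranspose_mul, conjTranspose_conjTranspose, Matrix.mul_assoc]
  have hF := channelFidelity_le N M hBstate
  rw [fidelity, idTensor_eq_linkProduct, idTensor_eq_linkProduct, linkProduct_vecMulVec_vec,
    linkProduct_vecMulVec_vec, hout hN, hout hM] at hF
  calc √(channelFidelity N M) ≤ _ := (Real.sqrt_le_left (traceNorm_nonneg _)).2 hF
    _ ≤ traceNorm (CFC.sqrt (choi N) * Sᴴ * (CFC.sqrt (choi M) * Sᴴ)ᴴ) :=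
        traceNorm_sqrt_mul_sqrt_le _ _
    _ = _ := by
        rw [← hS, conjTranspose_mul, conjTranspose_conjTranspose, sqrt_isHermitian]
        simp only [Matrix.mul_assoc]

theorem le_traceNorm_of_mem_rootFidelityValues {N M : Op c →ₗ[ℂ] Op d} {lam : ℝ}
    (hlam : lam ∈ rootFidelityValues N M) [Fintype r] [DecidableEq r] {ρ : Op (r × c)}
    (hρ : IsState ρ) :
    lam ≤ traceNorm (CFC.sqrt (idTensor r N ρ) * CFC.sqrt (idTensor r M ρ)) := by
  obtain ⟨Q, hQ, hle⟩ := hlam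
  have hmarginal : IsState (traceFst ρ)ᵀ :=
    ⟨(posSemidef_traceFst hρ.posSemidef).transpose, by
      rw [trace_transpose, trace_traceFst, hρ.trace_eq_one]⟩
  rw [idTensor_eq_linkProduct, idTensor_eq_linkProduct]
  calc lam ≤ (linkProduct ρ Q).trace.re := by
        rw [trace_linkProduct]
        exact smul_one_le_realPart_iff.1 hle _ hmarginal
    _ ≤ _ := re_trace_le_traceNorm_of_fromBlocks_posSemidef
        (linkProduct_fromBlocks_posSemidef hρ.posSemidef hQ)

variable [Nonempty c]

theorem le_sqrt_channelFidelity_of_mem_rootFidelityValues {N M : Op c →ₗ[ℂ] Op d} {lam : ℝ}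
    (hlam : lam ∈ rootFidelityValues N M) : lam ≤ √(channelFidelity N M) := by
  obtain h0 | h0 := le_total lam 0
  · exact h0.trans (Real.sqrt_nonneg _)
  refine Real.le_sqrt_of_sq_le (le_csInf ?_ ?_)
  · obtain ⟨ρ, hρ⟩ := exists_isState (n := Fin 1 × c)
    exact ⟨_, 1, ρ, hρ, rfl⟩
  · rintro _ ⟨k, ρ, hρ, rfl⟩
    exact pow_le_pow_left₀ h0 (le_traceNorm_of_mem_rootFidelityValues hlam hρ) 2

theorem sqrt_channelFidelity_mem_rootFidelityValues {N M : Op c →ₗ[ℂ] Op d}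
    (hN : (choi N).PosSemidef) (hM : (choi M).PosSemidef) :
    √(channelFidelity N M) ∈ rootFidelityValues N M := by
  let overlap : Op c →ₗ[ℝ] Op (c × d) →ₗ[ℝ] ℝ := LinearMap.mk₂ ℝ
    (fun σ V => ((σ ⊗ₖ (1 : Op d)) * (CFC.sqrt (choi M) * V * CFC.sqrt (choi N))).trace.re)
    (fun σ τ V => by simp [add_kronecker, Matrix.add_mul])
    (fun t σ V => by simp [smul_kronecker])
    (fun σ V W => by simp [Matrix.mul_add, Matrix.add_mul])
    (fun t σ V => by simp)
  have hpointwise (σ : Op c) (hσ : IsState σ) :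
      ∃ V ∈ Metric.closedBall (0 : Op (c × d)) 1, √(channelFidelity N M) ≤ overlap σ V := by
    obtain ⟨V, hV, htr⟩ := exists_re_trace_mul_eq_traceNorm
      (CFC.sqrt (choi N) * (σ ⊗ₖ (1 : Op d)) * CFC.sqrt (choi M))
    refine ⟨V, mem_closedBall_zero_iff.2 hV, ?_⟩
    calc √(channelFidelity N M) ≤ _ := sqrt_channelFidelity_le_traceNorm hN hM hσ
      _ = overlap σ V := by
        rw [← htr, Matrix.mul_assoc (CFC.sqrt _), ← Matrix.mul_assoc V, trace_mul_comm]
        simp only [overlap, LinearMap.mk₂_apply, Matrix.mul_assoc]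
  have : ProperSpace (Op (c × d)) := FiniteDimensional.proper ℂ _
  obtain ⟨V, hV, hle⟩ := exists_forall_le_of_forall_exists_le overlap isCompact_setOfPred_isState
    convex_setOfPred_isState exists_isState (isCompact_closedBall 0 1) (convex_closedBall 0 1)
    ⟨0, Metric.mem_closedBall_self zero_le_one⟩ hpointwise
  refine ⟨_, fromBlocks_posSemidef_iff.2 ⟨hN, hM, V, mem_closedBall_zero_iff.1 hV, rfl⟩,
    smul_one_le_realPart_iff.2 fun σ hσ => ?_⟩
  rw [← trace_kronecker_one_mul]
  exact hle σ hσ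

theorem rootFidelityValues_eq_Iic {N M : Op c →ₗ[ℂ] Op d} (hN : IsCompletelyPositive N)
    (hM : IsCompletelyPositive M) :
    rootFidelityValues N M = Set.Iic √(channelFidelity N M) := by
  rw [isCompletelyPositive_iff_posSemidef_choi] at hN hM
  exact Set.Subset.antisymm (fun _ => le_sqrt_channelFidelity_of_mem_rootFidelityValues)
    fun _ => mem_rootFidelityValues_of_le (sqrt_channelFidelity_mem_rootFidelityValues hN hM)

theorem sqrt_channelFidelity_le_re_trace_add {N M : Op c →ₗ[ℂ] Op d} (hN : IsCompletelyPositive N)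
    (hM : IsCompletelyPositive M) :
    √(channelFidelity N M) ≤ ((N 1).trace.re + (M 1).trace.re) / (2 * Fintype.card c) := by
  obtain ⟨Q, hQ, hle⟩ := (rootFidelityValues_eq_Iic hN hM).ge Set.self_mem_Iic
  have hcard : (0 : ℝ) < Fintype.card c := by exact_mod_cast Fintype.card_pos
  have hmixed := smul_one_le_realPart_iff.1 hle _
    (isState_inv_trace_smul PosSemidef.one one_ne_zero)
  have htrace := two_mul_re_trace_le_of_fromBlocks_posSemidef hQ
  rw [trace_choi, trace_choi, ← trace_traceSnd] at htrace
  rw [trace_one, smul_mul_assoc, Matrix.one_mul, trace_smul, smul_eq_mul, ← Complex.ofReal_natCast,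
    ← Complex.ofReal_inv, Complex.re_ofReal_mul, inv_mul_eq_div, le_div_iff₀ hcard] at hmixed
  rw [le_div_iff₀ (by positivity)]
  linarith

end ChannelFidelity

section Simulation

theorem transposeSnd_apply {c d : Type*} (X : Op (c × d)) (x y : c × d) :
    transposeSnd c d X x y = X (x.1, y.2) (y.1, x.2) :=
  rfl

theorem transposeSnd_single {c d : Type*} [DecidableEq c] [DecidableEq d] (i j : c) (k l : d) :
    transposeSnd c d (single (i, k) (j, l) 1) = single (i, l) (j, k) 1 := by
  ext x y
  simp only [transposeSnd_apply, single, of_apply, Prod.ext_iff]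
  exact if_congr (by tauto) rfl rfl

theorem transposeSnd_one {c d : Type*} [DecidableEq c] [DecidableEq d] :
    transposeSnd c d 1 = 1 := by
  ext x y
  simp only [transposeSnd_apply, Matrix.one_apply, Prod.ext_iff]
  exact if_congr (and_congr_right' eq_comm) rfl rfl

variable {a b ah bh a' b' : Type*}

theorem trace_simulate [Fintype a] [Fintype b] [Fintype a'] [Fintype b'] [Fintype ah]
    [Fintype bh] {P : Op ((a × ah) × (b × bh)) →ₗ[ℂ] Op (a' × b')}
    (hP : ∀ X, (P X).trace = X.trace) (ρ : Op (ah × bh)) (ω : Op (a × b)) :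
    (simulate ρ P ω).trace = ω.trace * ρ.trace := by
  rw [← trace_kronecker]
  exact (hP _).trans <|
    (Equiv.prodProdProdComm a b ah bh).symm.sum_comp fun i => (ω ⊗ₖ ρ) i i

variable [DecidableEq a] [DecidableEq b]

theorem transposeSnd_regroup_choi (P : Op (a × b) →ₗ[ℂ] Op (a' × b')) :
    transposeSnd (a × a') (b × b') (regroup (choi P)) =
      regroup (choi (transposeSnd a' b' ∘ₗ P ∘ₗ transposeSnd a b)) := by
  ext ⟨⟨i, x⟩, ⟨k, z⟩⟩ ⟨⟨j, y⟩, ⟨l, w⟩⟩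
  change choi P ((i, l), (x, w)) ((j, k), (y, z)) =
    choi (transposeSnd a' b' ∘ₗ P ∘ₗ transposeSnd a b) ((i, k), (x, z)) ((j, l), (y, w))
  rw [choi_apply, choi_apply, LinearMap.comp_apply, LinearMap.comp_apply, transposeSnd_single,
    transposeSnd_apply]

variable [Fintype a] [Fintype b] [Fintype a'] [Fintype b']

theorem isCPPTP_iff_choi {P : Op (a × b) →ₗ[ℂ] Op (a' × b')} :
    IsCPPTP P ↔ (choi P).PosSemidef ∧ traceSnd (choi P) = 1 ∧
      (transposeSnd (a × a') (b × b') (regroup (choi P))).PosSemidef := by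
  have hppt : IsCompletelyPositive (transposeSnd a' b' ∘ₗ P ∘ₗ transposeSnd a b) ↔
      (transposeSnd (a × a') (b × b') (regroup (choi P))).PosSemidef := by
    rw [isCompletelyPositive_iff_posSemidef_choi, transposeSnd_regroup_choi]
    exact (posSemidef_submatrix_equiv (Equiv.prodProdProdComm a b a' b').symm).symm
  rw [← and_assoc, ← isChannel_iff_choi, ← hppt]
  exact ⟨fun h => ⟨h.channel, h.ppt⟩, fun h => ⟨h.1, h.2⟩⟩

omit [DecidableEq a] [DecidableEq b] in
-- The witness is the completely depolarizing channel.
theorem exists_isCPPTP [Nonempty a'] [Nonempty b'] :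
    ∃ P : Op (a × b) →ₗ[ℂ] Op (a' × b'), IsCPPTP P := by
  classical
  let p : ℂ := (Fintype.card (a' × b') : ℂ)⁻¹
  have hp : 0 ≤ p := inv_nonneg.2 (Nat.cast_nonneg _)
  have hcard : (Fintype.card (a' × b') : ℂ) * p = 1 :=
    mul_inv_cancel₀ (Nat.cast_ne_zero.2 Fintype.card_ne_zero)
  have htranspose : transposeSnd (a × a') (b × b') (regroup (p • 1)) = p • 1 := by
    have hregroup : regroup (1 : Op ((a × b) × (a' × b'))) = 1 := submatrix_one_equiv _
    rw [show regroup (p • 1) = p • regroup (1 : Op ((a × b) × (a' × b'))) from rfl, hregroup,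
      map_smul, transposeSnd_one]
  refine ⟨ofChoi (p • 1), isCPPTP_iff_choi.2 ?_⟩
  rw [choi_ofChoi, htranspose]
  refine ⟨PosSemidef.one.smul hp, ?_, PosSemidef.one.smul hp⟩
  ext i j
  obtain rfl | h := eq_or_ne i j
  · simpa [traceSnd, Matrix.one_apply] using hcard
  · simp [traceSnd, Matrix.one_apply, h]

variable [DecidableEq a'] [DecidableEq b'] [Fintype ah] [Fintype bh]

theorem contractResource_apply (ρ : Op (ah × bh)) (P : Op (((a × ah) × (b × bh)) × (a' × b')))
    (i j : (a × b) × (a' × b')) :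
    contractResource ρ P i j = ∑ h, ∑ h', ρ h h' *
      P (((i.1.1, h.1), (i.1.2, h.2)), i.2) (((j.1.1, h'.1), (j.1.2, h'.2)), j.2) := by
  simp only [contractResource, traceFst, of_apply, Matrix.mul_apply, kroneckerMap_apply,
    Fintype.sum_prod_type (α₁ := ah × bh), transpose_apply, Matrix.one_apply, mul_ite, mul_one,
    mul_zero, ite_mul, zero_mul, Finset.sum_ite_eq, Finset.mem_univ, if_true]
  rw [Finset.sum_comm]
  rfl

theorem posSemidef_contractResource {ρ : Op (ah × bh)} (hρ : ρ.PosSemidef)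
    {P : Op (((a × ah) × (b × bh)) × (a' × b'))} (hP : P.PosSemidef) :
    (contractResource ρ P).PosSemidef := by
  convert (posSemidef_linkProduct (hρ.submatrix (Prod.snd : Unit × (ah × bh) → ah × bh))
    (hP.submatrix (resourceFirst a b ah bh a' b').symm)).submatrix (Prod.mk ()) using 1
  ext i j
  rw [contractResource_apply]
  rfl

variable [DecidableEq ah] [DecidableEq bh]

theorem choi_simulate (ρ : Op (ah × bh)) (P : Op ((a × ah) × (b × bh)) →ₗ[ℂ] Op (a' × b')) :
    choi (simulate ρ P) = contractResource ρ (choi P) := by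
  ext ⟨i, x⟩ ⟨j, y⟩
  rw [choi_apply, contractResource_apply]
  change P (regroup (single i j 1 ⊗ₖ ρ)) x y = _
  rw [apply_eq_sum_choi, ← (Equiv.prodProdProdComm a b ah bh).sum_comp]
  simp_rw [← (Equiv.prodProdProdComm a b ah bh).sum_comp]
  simp only [regroup, reindex_apply, submatrix_apply, Equiv.symm_apply_apply, kroneckerMap_apply,
    Fintype.sum_prod_type (α₁ := a × b), single, of_apply]
  rw [Finset.sum_eq_single i _ (by simp)]
  · refine Finset.sum_congr rfl fun h _ => ?_
    rw [Finset.sum_eq_single j _ (by simp)]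
    · simp
    · intro k _ hk
      simp [hk.symm]
  · intro k _ hk
    simp [hk.symm]

omit [DecidableEq a] [DecidableEq b] [DecidableEq a'] [DecidableEq b'] [DecidableEq ah]
  [DecidableEq bh] in
theorem isCompletelyPositive_simulate {ρ : Op (ah × bh)} (hρ : ρ.PosSemidef)
    {P : Op ((a × ah) × (b × bh)) →ₗ[ℂ] Op (a' × b')} (hP : IsCompletelyPositive P) :
    IsCompletelyPositive (simulate ρ P) := by
  classical
  rw [isCompletelyPositive_iff_posSemidef_choi] at hP ⊢
  rw [choi_simulate]
  exact posSemidef_contractResource hρ hP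

theorem mem_feasibleValues_iff {N : Op (a × b) →ₗ[ℂ] Op (a' × b')} {ρ : Op (ah × bh)} {lam : ℝ} :
    lam ∈ feasibleValues N ρ ↔ 0 ≤ lam ∧ ∃ P : Op ((a × ah) × (b × bh)) →ₗ[ℂ] Op (a' × b'),
      IsCPPTP P ∧ lam ∈ rootFidelityValues N (simulate ρ P) := by
  constructor
  · rintro ⟨P, Q, h⟩
    refine ⟨h.lam_nonneg, ofChoi P, isCPPTP_iff_choi.2 ?_, Q, ?_, h.lam_le⟩
    · rw [choi_ofChoi]
      exact ⟨h.posSemidef, h.tracePreserving, h.ppt⟩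
    · rw [choi_simulate, choi_ofChoi]
      exact h.block
  · rintro ⟨h0, P, hP, Q, hQ, hlam⟩
    obtain ⟨hpos, htrace, hppt⟩ := isCPPTP_iff_choi.1 hP
    exact ⟨choi P, Q, h0, hpos, hlam, hppt, htrace, choi_simulate ρ P ▸ hQ⟩

end Simulation

section SemidefiniteProgram

variable {a b ah bh a' b' : Type*} [Fintype a] [Fintype b] [Fintype ah] [Fintype bh] [Fintype a']
  [Fintype b'] [DecidableEq a'] [DecidableEq b']

/-- The channel fidelities between `N` and its simulations with resource `ρ` by C-PPT-P channels. -/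
def simulationFidelities (N : Op (a × b) →ₗ[ℂ] Op (a' × b')) (ρ : Op (ah × bh)) : Set ℝ :=
  {f | ∃ P : Op ((a × ah) × (b × bh)) →ₗ[ℂ] Op (a' × b'), IsCPPTP P ∧
    channelFidelity N (simulate ρ P) = f}

variable {N : Op (a × b) →ₗ[ℂ] Op (a' × b')} {ρ : Op (ah × bh)}

theorem simulationFidelities_nonempty [Nonempty a'] [Nonempty b'] :
    (simulationFidelities N ρ).Nonempty := by
  classical
  obtain ⟨P, hP⟩ := exists_isCPPTP (a := a × ah) (b := b × bh) (a' := a') (b' := b')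
  exact ⟨_, P, hP, rfl⟩

theorem nonneg_of_mem_simulationFidelities {f : ℝ} (hf : f ∈ simulationFidelities N ρ) :
    0 ≤ f := by
  obtain ⟨P, -, rfl⟩ := hf
  exact channelFidelity_nonneg _ _

theorem bddAbove_simulationFidelities [Nonempty a] [Nonempty b] (hN : IsCompletelyPositive N)
    (hρ : ρ.PosSemidef) : BddAbove (simulationFidelities N ρ) := by
  classical
  refine ⟨(((N 1).trace.re + ((1 : Op (a × b)).trace * ρ.trace).re) /
    (2 * Fintype.card (a × b))) ^ 2, ?_⟩
  rintro _ ⟨P, hP, rfl⟩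
  have h := sqrt_channelFidelity_le_re_trace_add hN
    (isCompletelyPositive_simulate hρ hP.channel.completelyPositive)
  rw [trace_simulate hP.channel.tracePreserving] at h
  exact (Real.sqrt_le_left ((Real.sqrt_nonneg _).trans h)).1 h

theorem errPPT_eq_one_sub_sSup (hne : (simulationFidelities N ρ).Nonempty)
    (hbdd : BddAbove (simulationFidelities N ρ)) :
    errPPT N ρ = 1 - sSup (simulationFidelities N ρ) := by
  have hanti : Antitone fun f : ℝ => 1 - f := fun _ _ h => sub_le_sub_left h 1
  rw [hanti.map_csSup_of_continuousAt (by fun_prop) hne hbdd, errPPT]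
  congr 1
  ext e
  simp only [simulationFidelities, Set.mem_ofPred_eq, Set.mem_image, exists_exists_and_eq_and,
    eq_comm (a := e)]

variable [DecidableEq a] [DecidableEq b] [DecidableEq ah] [DecidableEq bh] [Nonempty a]
  [Nonempty b]

theorem mem_feasibleValues_iff_exists_le_sqrt (hN : IsCompletelyPositive N) (hρ : ρ.PosSemidef)
    {lam : ℝ} :
    lam ∈ feasibleValues N ρ ↔ 0 ≤ lam ∧ ∃ f ∈ simulationFidelities N ρ, lam ≤ √f := by
  rw [mem_feasibleValues_iff]
  refine and_congr_right' ?_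
  simp only [simulationFidelities, Set.mem_ofPred_eq, exists_exists_and_eq_and]
  refine exists_congr fun P => and_congr_right fun hP => ?_
  rw [rootFidelityValues_eq_Iic hN
    (isCompletelyPositive_simulate hρ hP.channel.completelyPositive), Set.mem_Iic]

theorem isLUB_feasibleValues [Nonempty a'] [Nonempty b'] (hN : IsCompletelyPositive N)
    (hρ : ρ.PosSemidef) :
    IsLUB (feasibleValues N ρ) √(sSup (simulationFidelities N ρ)) := by
  constructor
  · intro lam hlam
    obtain ⟨-, f, hf, hle⟩ := (mem_feasibleValues_iff_exists_le_sqrt hN hρ).1 hlam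
    exact hle.trans (Real.sqrt_le_sqrt (le_csSup (bddAbove_simulationFidelities hN hρ) hf))
  · intro u hu
    have hsqrt (f : ℝ) (hf : f ∈ simulationFidelities N ρ) : √f ≤ u :=
      hu ((mem_feasibleValues_iff_exists_le_sqrt hN hρ).2 ⟨Real.sqrt_nonneg f, f, hf, le_rfl⟩)
    obtain ⟨f, hf⟩ := simulationFidelities_nonempty (N := N) (ρ := ρ)
    exact Real.sqrt_le_iff.2 ⟨(Real.sqrt_nonneg f).trans (hsqrt f hf),
      csSup_le ⟨f, hf⟩ fun g hg => (Real.sqrt_le_iff.1 (hsqrt g hg)).2⟩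

end SemidefiniteProgram

end BipartiteSim

open BipartiteSim in
theorem mainTheorem7_general {a b ah bh a' b' : Type*}
    [Fintype a] [Fintype b] [Fintype ah] [Fintype bh] [Fintype a'] [Fintype b']
    [DecidableEq a] [DecidableEq b] [DecidableEq ah] [DecidableEq bh]
    [DecidableEq a'] [DecidableEq b'] [Nonempty a] [Nonempty b] [Nonempty a'] [Nonempty b']
    {N : Op (a × b) →ₗ[ℂ] Op (a' × b')} (hN : IsCompletelyPositive N)
    {ρ : Op (ah × bh)} (hρ : ρ.PosSemidef) :
    (feasibleValues N ρ).Nonempty ∧ BddAbove (feasibleValues N ρ) ∧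
      errPPT N ρ = 1 - sSup (feasibleValues N ρ) ^ 2 := by
  have hlub := isLUB_feasibleValues hN hρ
  refine ⟨hlub.nonempty, hlub.bddAbove, ?_⟩
  rw [hlub.csSup_eq hlub.nonempty,
    Real.sq_sqrt (Real.sSup_nonneg fun _ => nonneg_of_mem_simulationFidelities)]
  exact errPPT_eq_one_sub_sSup simulationFidelities_nonempty (bddAbove_simulationFidelities hN hρ)

theorem mainTheorem7 {a b ah bh a' b' : Type*}
    [Fintype a] [Fintype b] [Fintype ah] [Fintype bh] [Fintype a'] [Fintype b']
    [DecidableEq a] [DecidableEq b] [DecidableEq ah] [DecidableEq bh]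
    [DecidableEq a'] [DecidableEq b'] [Nonempty a] [Nonempty b]
    (N : BipartiteSim.Op (a × b) →ₗ[ℂ] BipartiteSim.Op (a' × b'))
    (hN : BipartiteSim.IsChannel N)
    (ρ : BipartiteSim.Op (ah × bh)) (hρ : BipartiteSim.IsState ρ) :
    (BipartiteSim.feasibleValues N ρ).Nonempty ∧
      BddAbove (BipartiteSim.feasibleValues N ρ) ∧
      BipartiteSim.errPPT N ρ = 1 - (sSup (BipartiteSim.feasibleValues N ρ)) ^ 2 := by
  obtain ⟨_, _⟩ := nonempty_prod.1 hN.nonempty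
  exact mainTheorem7_general hN.completelyPositive hρ.posSemidef
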